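/- A \emph{program} is a finite sequence of instructions operating on square complex matrices. It starts with two input matrices $Z_1,Z_2\in M_n(\mathbb{C})$, and each instruction produces a new matrix, which may be reused afterwards without further cost: the identity matrix, the sum or the product of two matrices already available, a scalar multiple $cX$ ($c\in\mathbb{C}$), the entrywise complex conjugate $\overline{X}$, or the inverse $X^{-1}$ of a matrix $X$ already available (undefined if $X$ is not invertible). The program does not depend on $n$. (1) Let $P$ be a program such that for infinitely many $n$ (in particular, if for all $n$) there is a nonempty open set of pairs $(Z_1,Z_2)\in M_n(\mathbb{C})\times M_n(\mathbb{C})$, with $Z_1$ and $Z_1+Z_2\overline{Z_1}^{-1}\overline{Z_2}$ invertible, on which all inversions of $P$ are defined and one fixed result of $P$ equals $$\left(Z_1+Z_2\overline{Z_1}^{-1}\overline{Z_2}\right)^{-1}.$$ Then $P$ contains at least one addition and at least two inversions, however many multiplications, additions, scalar multiplications and conjugations it uses. (2) For $Z=A+iB+jC+kD\in M_n(\mathbb{H})$ with $A,B,C,D\in M_n(\mathbb{R})$ put $Z_1=A+iB$ and $Z_2=C+iD$. Let $P$ be a program such that for infinitely many $n$ there is a nonempty open set of $Z\in M_n(\mathbb{H})$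 on which $P$, with the input $(Z_1,Z_2)$, is defined and two fixed results $X,Y\in M_n(\mathbb{C})$ of $P$ satisfy $Z^{-1}=X+jY$. Then $P$ contains at least one addition and at least two inversions. (3) Complex Frobenius inversion attains these bounds. It consists of two programs, each with exactly one addition and two inversions. For every $n$ and every invertible $Z\in M_n(\mathbb{H})$: if $Z_1$ is invertible, then $$X_1=\overline{Z_1}^{-1},\quad X_2=X_1\overline{Z_2},\quad X_3=Z_2X_2,\quad X_4=(Z_1+X_3)^{-1},\quad X_5=-X_2X_4$$ are defined and $Z^{-1}=X_4+jX_5$; if $Z_2$ is invertible, then $$X_1=\overline{Z_2}^{-1},\quad X_2=X_1\overline{Z_1},\quad X_3=Z_1X_2,\quad X_4=(X_3+Z_2)^{-1},\quad X_5=X_2X_4$$ are defined and $Z^{-1}=X_5-jX_4$. Moreover, whenever $Z_1$ and $Z_1+Z_2\overline{Z_1}^{-1}\overline{Z_2}$ are invertible, the first program computes $X_4=(Z_1+Z_2\overline{Z_1}^{-1}\overline{Z_2})^{-1}$. Hence complex Frobenius inversion uses the fewest possible complex matrix inversions for inverting quaternion matrices. -/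

import Mathlib

open Filter Matrix

noncomputable section

namespace FrobInv

/-- The algebra `M_n(ℂ)`. -/
abbrev CMat (n : ℕ) : Type := Matrix (Fin n) (Fin n) ℂ

/-- The algebra `M_n(ℍ)`. -/
abbrev HMat (n : ℕ) : Type := Matrix (Fin n) (Fin n) (Quaternion ℝ)

/-- The entrywise complex conjugate of a complex matrix (no transposition). -/
def conjMat {n : ℕ} (X : CMat n) : CMat n := X.map (starRingEnd ℂ)

/-! ### Straight-line programs over complex matrices

A program is a list of instructions. Registers `0` and `1` hold the two input matrices; the
`m`-th instruction (counted from zero) stores its result in register `m + 2`. The arguments of an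
instruction are register numbers, so intermediate results may be reused at no cost. A program does
not mention the size `n` of the matrices. -/

/-- One operation on square complex matrices. `one` provides the identity matrix, so that
polynomial expressions with a constant term are allowed. -/
inductive Instr : Type
  | one : Instr
  | add (i j : ℕ) : Instr
  | mul (i j : ℕ) : Instr
  | smul (c : ℂ) (i : ℕ) : Instr
  | conj (i : ℕ) : Instr
  | inv (i : ℕ) : Instr

abbrev Program : Type := List Instr

open Classical in
/-- The value of an instruction on the registers `S`. It is undefined when a register that has not
been written is read, or when a matrix that is not invertible is to be inverted. -/
def Instr.eval {n : ℕ} (S : List (CMat n)) : Instr → Option (CMat n)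
  | .one => some 1
  | .add i j => S[i]?.bind fun X => S[j]?.bind fun Y => some (X + Y)
  | .mul i j => S[i]?.bind fun X => S[j]?.bind fun Y => some (X * Y)
  | .smul c i => S[i]?.bind fun X => some (c • X)
  | .conj i => S[i]?.bind fun X => some (conjMat X)
  | .inv i => S[i]?.bind fun X => if IsUnit X then some X⁻¹ else none

/-- Execution of a program from the register contents `S`; the result is the list of all register
contents at the end, or `none` if some instruction was undefined. -/
def run {n : ℕ} : Program → List (CMat n) → Option (List (CMat n))
  | [], S => some S
  | I :: P, S => (I.eval S).bind fun X => run P (S ++ [X])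

/-- On the input `(Z₁, Z₂)` the program `P` terminates with all inversions defined, and then the
register `r` contains `W`. -/
def Returns {n : ℕ} (P : Program) (r : ℕ) (Z₁ Z₂ W : CMat n) : Prop :=
  ∃ S, run P [Z₁, Z₂] = some S ∧ S[r]? = some W

def Instr.isInv : Instr → Bool
  | .inv _ => true
  | _ => false

def Instr.isAdd : Instr → Bool
  | .add _ _ => true
  | _ => false

/-- The number of matrix inversions of a program. -/
def invCount (P : Program) : ℕ := P.countP Instr.isInv

/-- The number of matrix additions of a program (a subtraction is an addition after a scalar
multiplication by `-1`). -/
def addCount (P : Program) : ℕ := P.countP Instr.isAdd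

/-! ### The matrix to be computed -/

/-- `Z₁ + Z₂ (conj Z₁)⁻¹ (conj Z₂)`. -/
def schur {n : ℕ} (Z₁ Z₂ : CMat n) : CMat n :=
  Z₁ + Z₂ * (conjMat Z₁)⁻¹ * conjMat Z₂

/-- In size `n`, register `r` of the program `P` holds `(Z₁ + Z₂ (conj Z₁)⁻¹ (conj Z₂))⁻¹` for all
inputs from some nonempty open set on which both inverses in this expression exist. -/
def ComputesSchurInv (P : Program) (r n : ℕ) : Prop :=
  ∃ U : Set (CMat n × CMat n), IsOpen U ∧ U.Nonempty ∧
    ∀ Z ∈ U, IsUnit Z.1 ∧ IsUnit (schur Z.1 Z.2) ∧ Returns P r Z.1 Z.2 (schur Z.1 Z.2)⁻¹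

/-! ### Quaternion matrices -/

/-- `A + iB` for `Z = A + iB + jC + kD`. -/
def part₁ {n : ℕ} (Z : HMat n) : CMat n := Z.map fun q => (⟨q.re, q.imI⟩ : ℂ)

/-- `C + iD` for `Z = A + iB + jC + kD`. -/
def part₂ {n : ℕ} (Z : HMat n) : CMat n := Z.map fun q => (⟨q.imJ, q.imK⟩ : ℂ)

/-- The quaternion unit `j`. -/
def quatJ : Quaternion ℝ := ⟨0, 0, 1, 0⟩

/-- The quaternion matrix `X + jY` for complex matrices `X` and `Y`. -/
def ofParts {n : ℕ} (X Y : CMat n) : HMat n :=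
  X.map Quaternion.coeComplex + quatJ • Y.map Quaternion.coeComplex

/-- Given `A + iB` and `C + iD`, the program `P` returns in its registers `r` and `s` complex
matrices `X` and `Y` such that `X + jY` is the inverse of `Z = A + iB + jC + kD`. -/
def Inverts {n : ℕ} (P : Program) (r s : ℕ) (Z : HMat n) : Prop :=
  ∃ X Y : CMat n, Returns P r (part₁ Z) (part₂ Z) X ∧ Returns P s (part₁ Z) (part₂ Z) Y ∧
    Z * ofParts X Y = 1 ∧ ofParts X Y * Z = 1

/-- In size `n`, the program `P` inverts all quaternion matrices from some nonempty open set. -/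
def ComputesQuatInv (P : Program) (r s n : ℕ) : Prop :=
  ∃ U : Set (HMat n), IsOpen U ∧ U.Nonempty ∧ ∀ Z ∈ U, Inverts P r s Z

/-- Complex Frobenius inversion when `A + iB` is invertible. With `Z₁ = A + iB`, `Z₂ = C + iD`, the
registers `4`, `5`, `6`, `8`, `10` hold `X₁ = (conj Z₁)⁻¹`, `X₂ = X₁ (conj Z₂)`, `X₃ = Z₂ X₂`,
`X₄ = (Z₁ + X₃)⁻¹` and `X₅ = -X₂ X₄`; the result is `X₄ + j X₅`. -/
def frobenius₁ : Program :=
  [.conj 0, .conj 1, .inv 2, .mul 4 3, .mul 1 5, .add 0 6, .inv 7, .mul 5 8, .smul (-1) 9]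

/-- Complex Frobenius inversion when `C + iD` is invertible. With `Z₁ = A + iB`, `Z₂ = C + iD`, the
registers `4`, `5`, `6`, `8`, `9`, `10` hold `X₁ = (conj Z₂)⁻¹`, `X₂ = X₁ (conj Z₁)`, `X₃ = Z₁ X₂`,
`X₄ = (X₃ + Z₂)⁻¹`, `X₅ = X₂ X₄` and `-X₄`; the result is `X₅ - j X₄`. -/
def frobenius₂ : Program :=
  [.conj 0, .conj 1, .inv 3, .mul 4 2, .mul 0 5, .add 6 1, .inv 7, .mul 5 8, .smul (-1) 8]

end FrobInv

end

/-!
The lower bounds rest on replacing the conjugates of the inputs by independent variables. In the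
*complexified* execution of a program a register holds a pair of matrices, conjugation swaps the two
components, and the inputs are `(x, z)` and `(y, w)`; the original execution is the case `z = conj x`,
`w = conj y`. A single inversion thus inverts a matrix together with its formal conjugate.

*Continuation.* Suppose the program is defined at a complexified point with `z` invertible and
`x + y z⁻¹ w = 0` (`DefinedAtDegenerate`). This point is joined to the given open set of inputs by a
quadratic curve that consists of inputs at the real parameters. Along the curve all registers are
rational functions of one variable, so an identity such as `W * schur Z₁ Z₂ = 1`, or the complex form
of `Z * Z⁻¹ = 1`, persists up to the end point, where it reads `0 = 1`
(`not_computesSchurInv`, `not_computesQuatInv`).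

*Such a point exists if one of the bounds is violated.* Without additions, a register that is
nonzero at some input is invertible whenever the inputs are, so `x = -1`, `y = z = w = 1` will do;
without inversions every point will do. With exactly one inversion, the inverted pair consists of
values of two nonzero noncommutative polynomials that do not depend on the size `n`. They have to be
made invertible under the constraint `x + y z⁻¹ w = 0` (`exists_isUnit_ncEval`). For this, `x, y, z, w`
are taken to be a small multiple of the weighted cyclic shifts with the weights
`-t j ^ 3, t j, 1, t j ^ 2` at the position `j`. After removal of a power of the small factor only the
part of lowest degree `m` matters. It becomes a diagonal matrix times the `m`-th power of the shift,
and for `m ≤ n` distinct words of length `m` contribute distinct monomials in the `t j` to each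
diagonal entry, because a word passes each position at most once and the four weights have distinct
exponents (`wordExp_injective`). So the diagonal entries are nonzero polynomials in `t`.

All inductions over programs are instances of one simulation lemma, `Sim.run`.

For the upper bound, `Z = Z₁ + Z₂ j`, and `Z (X + jY) = 1` is the pair of equations
`Z₁ X - Z₂ Y = 1`, `(conj Z₂) X + (conj Z₁) Y = 0`; the two programs solve it by eliminating `Y` or `X`.
-/

open scoped Quaternion

noncomputable section

namespace FrobInv

/-! ### Interpretations of programs and simulations between them -/

/-- An interpretation of the instructions in a type `α`. Only inversion may be undefined. -/
structure Ops (α : Type) where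
  /-- the value of the instruction `one` -/
  one : α
  /-- addition -/
  add : α → α → α
  /-- multiplication -/
  mul : α → α → α
  /-- multiplication by a scalar -/
  smul : ℂ → α → α
  /-- conjugation -/
  conj : α → α
  /-- the partial operation of inversion -/
  inv : α → Option α

/-- The value of an instruction on the registers `S`, in the interpretation `o`. -/
def Ops.eval {α : Type} (o : Ops α) (S : List α) : Instr → Option α
  | .one => some o.one
  | .add i j => S[i]?.bind fun X => S[j]?.bind fun Y => some (o.add X Y)
  | .mul i j => S[i]?.bind fun X => S[j]?.bind fun Y => some (o.mul X Y)
  | .smul c i => S[i]?.bind fun X => some (o.smul c X)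
  | .conj i => S[i]?.bind fun X => some (o.conj X)
  | .inv i => S[i]?.bind fun X => o.inv X

/-- Execution of a program in the interpretation `o`. -/
def Ops.run {α : Type} (o : Ops α) : Program → List α → Option (List α)
  | [], S => some S
  | I :: P, S => (o.eval S I).bind fun X => o.run P (S ++ [X])

/-- The relation `ρ` is preserved by all operations. Additions and inversions are considered only
if `okAdd` and `okInv` hold, respectively; an inverse that exists on the left-hand side has to exist
on the right-hand side as well. -/
structure Sim {α β : Type} (a : Ops α) (b : Ops β) (ρ : α → β → Prop) (okAdd okInv : Prop) :
    Prop where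
  one : ρ a.one b.one
  add : okAdd → ∀ {x y x' y'}, ρ x x' → ρ y y' → ρ (a.add x y) (b.add x' y')
  mul : ∀ {x y x' y'}, ρ x x' → ρ y y' → ρ (a.mul x y) (b.mul x' y')
  smul : ∀ (c : ℂ) {x x'}, ρ x x' → ρ (a.smul c x) (b.smul c x')
  conj : ∀ {x x'}, ρ x x' → ρ (a.conj x) (b.conj x')
  inv : okInv → ∀ {x x' u}, ρ x x' → a.inv x = some u → ∃ u', b.inv x' = some u' ∧ ρ u u'

theorem exists_getElem?_of_forall₂ {α β : Type} {ρ : α → β → Prop} {S : List α} {R : List β}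
    (h : List.Forall₂ ρ S R) {i : ℕ} {x : α} (hx : S[i]? = some x) :
    ∃ y, R[i]? = some y ∧ ρ x y := by
  obtain ⟨hi, rfl⟩ := List.getElem?_eq_some_iff.1 hx
  have hi' : i < R.length := h.length_eq ▸ hi
  exact ⟨R[i], List.getElem?_eq_getElem hi', h.get hi hi'⟩

theorem Sim.eval {α β : Type} {a : Ops α} {b : Ops β} {ρ : α → β → Prop} {okAdd okInv : Prop}
    (h : Sim a b ρ okAdd okInv) {I : Instr} (hA : okAdd ∨ I.isAdd = false)
    (hI : okInv ∨ I.isInv = false) {S : List α} {R : List β} (hSR : List.Forall₂ ρ S R) {x : α}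
    (hx : a.eval S I = some x) : ∃ y, b.eval R I = some y ∧ ρ x y := by
  cases I with
  | one =>
    obtain rfl : a.one = x := by simpa [Ops.eval] using hx
    exact ⟨_, rfl, h.one⟩
  | add i j =>
    simp only [Ops.eval, Option.bind_eq_some_iff, Option.some.injEq] at hx ⊢
    obtain ⟨u, hu, v, hv, rfl⟩ := hx
    obtain ⟨u', hu', huu⟩ := exists_getElem?_of_forall₂ hSR hu
    obtain ⟨v', hv', hvv⟩ := exists_getElem?_of_forall₂ hSR hv
    exact ⟨_, ⟨u', hu', v', hv', rfl⟩, h.add (by simpa [Instr.isAdd] using hA) huu hvv⟩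
  | mul i j =>
    simp only [Ops.eval, Option.bind_eq_some_iff, Option.some.injEq] at hx ⊢
    obtain ⟨u, hu, v, hv, rfl⟩ := hx
    obtain ⟨u', hu', huu⟩ := exists_getElem?_of_forall₂ hSR hu
    obtain ⟨v', hv', hvv⟩ := exists_getElem?_of_forall₂ hSR hv
    exact ⟨_, ⟨u', hu', v', hv', rfl⟩, h.mul huu hvv⟩
  | smul c i =>
    simp only [Ops.eval, Option.bind_eq_some_iff, Option.some.injEq] at hx ⊢
    obtain ⟨u, hu, rfl⟩ := hx
    obtain ⟨u', hu', huu⟩ := exists_getElem?_of_forall₂ hSR hu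
    exact ⟨_, ⟨u', hu', rfl⟩, h.smul c huu⟩
  | conj i =>
    simp only [Ops.eval, Option.bind_eq_some_iff, Option.some.injEq] at hx ⊢
    obtain ⟨u, hu, rfl⟩ := hx
    obtain ⟨u', hu', huu⟩ := exists_getElem?_of_forall₂ hSR hu
    exact ⟨_, ⟨u', hu', rfl⟩, h.conj huu⟩
  | inv i =>
    simp only [Ops.eval, Option.bind_eq_some_iff] at hx ⊢
    obtain ⟨u, hu, hx⟩ := hx
    obtain ⟨u', hu', huu⟩ := exists_getElem?_of_forall₂ hSR hu
    obtain ⟨y, hy, hxy⟩ := h.inv (by simpa [Instr.isInv] using hI) huu hx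
    exact ⟨y, ⟨u', hu', hy⟩, hxy⟩

/-- A program that is defined in the interpretation `a` is defined in every interpretation that
simulates `a`, with related results. -/
theorem Sim.run {α β : Type} {a : Ops α} {b : Ops β} {ρ : α → β → Prop} {okAdd okInv : Prop}
    (h : Sim a b ρ okAdd okInv) {P : Program} (hA : okAdd ∨ addCount P = 0)
    (hI : okInv ∨ invCount P = 0) {S S' : List α} {R : List β} (hSR : List.Forall₂ ρ S R)
    (hS : a.run P S = some S') : ∃ R', b.run P R = some R' ∧ List.Forall₂ ρ S' R' := by
  induction P generalizing S R with
  | nil =>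
    obtain rfl : S = S' := by simpa [Ops.run] using hS
    exact ⟨R, rfl, hSR⟩
  | cons I P ih =>
    simp only [Ops.run, Option.bind_eq_some_iff] at hS ⊢
    obtain ⟨x, hx, hS⟩ := hS
    have hA' : okAdd ∨ I.isAdd = false ∧ addCount P = 0 := by
      refine hA.imp_right fun h0 => ?_
      cases hb : I.isAdd <;> simp_all [addCount]
    have hI' : okInv ∨ I.isInv = false ∧ invCount P = 0 := by
      refine hI.imp_right fun h0 => ?_
      cases hb : I.isInv <;> simp_all [invCount]
    obtain ⟨y, hy, hxy⟩ :=
      h.eval (hA'.imp_right And.left) (hI'.imp_right And.left) hSR hx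
    obtain ⟨R', hR', hSR'⟩ := ih (hA'.imp_right And.right) (hI'.imp_right And.right)
      (List.rel_append hSR (.cons hxy .nil)) hS
    exact ⟨R', ⟨y, hy, hR'⟩, hSR'⟩

theorem Ops.run_append {α : Type} (o : Ops α) (P Q : Program) (S : List α) :
    o.run (P ++ Q) S = (o.run P S).bind (o.run Q) := by
  induction P generalizing S with
  | nil => rfl
  | cons I P ih =>
    simp only [List.cons_append, Ops.run, Option.bind_assoc]
    congr 1
    funext X
    exact ih _

/-! ### Complexified execution -/

open Classical in
/-- The interpretation of instructions by complex matrices. -/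
def matOps (n : ℕ) : Ops (CMat n) where
  one := 1
  add X Y := X + Y
  mul X Y := X * Y
  smul c X := c • X
  conj X := conjMat X
  inv X := if IsUnit X then some X⁻¹ else none

theorem run_eq_matOps_run {n : ℕ} (P : Program) (S : List (CMat n)) :
    run P S = (matOps n).run P S := by
  induction P generalizing S with
  | nil => rfl
  | cons I P ih =>
    have h : I.eval S = (matOps n).eval S I := by cases I <;> rfl
    simp only [run, Ops.run, h, ih]

open Classical in
/-- The complexified interpretation: a register holds a pair of matrices, the second of which stands
for the conjugate of the first but is independent of it. Conjugation swaps the components. -/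
def pairOps (n : ℕ) : Ops (CMat n × CMat n) where
  one := 1
  add X Y := X + Y
  mul X Y := X * Y
  smul c X := (c • X.1, starRingEnd ℂ c • X.2)
  conj X := X.swap
  inv X := if IsUnit X.1 ∧ IsUnit X.2 then some (X.1⁻¹, X.2⁻¹) else none

/-- The complexified inputs `Z₁ = x`, `Z₂ = y`, with `z` and `w` in the place of `conj Z₁` and
`conj Z₂`. -/
def pairInput {n : ℕ} (x y z w : CMat n) : List (CMat n × CMat n) := [(x, z), (y, w)]

theorem conjMat_mul {n : ℕ} (X Y : CMat n) : conjMat (X * Y) = conjMat X * conjMat Y :=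
  Matrix.map_mul

theorem conjMat_add {n : ℕ} (X Y : CMat n) : conjMat (X + Y) = conjMat X + conjMat Y :=
  map_add (starRingEnd ℂ).mapMatrix X Y

theorem conjMat_sub {n : ℕ} (X Y : CMat n) : conjMat (X - Y) = conjMat X - conjMat Y :=
  map_sub (starRingEnd ℂ).mapMatrix X Y

theorem conjMat_smul {n : ℕ} (c : ℂ) (X : CMat n) :
    conjMat (c • X) = starRingEnd ℂ c • conjMat X := by
  ext; simp [conjMat]

theorem conjMat_one {n : ℕ} : conjMat (1 : CMat n) = 1 :=
  map_one (starRingEnd ℂ).mapMatrix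

theorem conjMat_conjMat {n : ℕ} (X : CMat n) : conjMat (conjMat X) = X := by
  ext; simp [conjMat]

theorem isUnit_conjMat {n : ℕ} {X : CMat n} (h : IsUnit X) : IsUnit (conjMat X) :=
  h.map (starRingEnd ℂ).mapMatrix

theorem conjMat_inv {n : ℕ} {X : CMat n} (h : IsUnit X) : conjMat X⁻¹ = (conjMat X)⁻¹ := by
  symm
  apply Matrix.inv_eq_left_inv
  rw [← conjMat_mul, Matrix.nonsing_inv_mul _ ((Matrix.isUnit_iff_isUnit_det X).1 h), conjMat_one]

/-- Complexified execution at a point `(Z₁, Z₂, conj Z₁, conj Z₂)` extends the execution of the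
program on `(Z₁, Z₂)`. -/
theorem sim_matOps_pairOps (n : ℕ) :
    Sim (matOps n) (pairOps n) (fun X A => A = (X, conjMat X)) True True where
  one := by simp [matOps, pairOps, conjMat_one, Prod.one_eq_mk]
  add := by rintro - x y _ _ rfl rfl; simp [matOps, pairOps, conjMat_add]
  mul := by rintro x y _ _ rfl rfl; simp [matOps, pairOps, conjMat_mul]
  smul := by rintro c x _ rfl; simp [matOps, pairOps, conjMat_smul]
  conj := by rintro x _ rfl; simp [matOps, pairOps, conjMat_conjMat]
  inv := by
    rintro - x _ u rfl hu
    simp only [matOps, Option.ite_none_right_eq_some, Option.some.injEq] at hu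
    obtain ⟨hx, rfl⟩ := hu
    exact ⟨(x⁻¹, conjMat x⁻¹), by simp [pairOps, hx, isUnit_conjMat hx, conjMat_inv hx], rfl⟩

theorem exists_pairOps_run_of_returns {n : ℕ} {P : Program} {r : ℕ} {Z₁ Z₂ W : CMat n}
    (h : Returns P r Z₁ Z₂ W) :
    ∃ R, (pairOps n).run P (pairInput Z₁ Z₂ (conjMat Z₁) (conjMat Z₂)) = some R ∧
      R[r]? = some (W, conjMat W) := by
  obtain ⟨S, hS, hr⟩ := h
  rw [run_eq_matOps_run] at hS
  obtain ⟨R, hR, hSR⟩ := (sim_matOps_pairOps n).run (.inl trivial) (.inl trivial)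
    (R := pairInput Z₁ Z₂ (conjMat Z₁) (conjMat Z₂)) (.cons rfl (.cons rfl .nil)) hS
  obtain ⟨_, hy, rfl⟩ := exists_getElem?_of_forall₂ hSR hr
  exact ⟨R, hR, hy⟩

/-! ### Quaternion matrices as pairs of complex matrices -/

/-- The first complex component `a + ib` of a quaternion `a + ib + jc + kd`. -/
def quatFst : Quaternion ℝ →+ ℂ where
  toFun q := ⟨q.re, q.imI⟩
  map_zero' := rfl
  map_add' _ _ := rfl

/-- The second complex component `c + id` of a quaternion `a + ib + jc + kd`. -/
def quatSnd : Quaternion ℝ →+ ℂ where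
  toFun q := ⟨q.imJ, q.imK⟩
  map_zero' := rfl
  map_add' _ _ := rfl

theorem re_quatFst (q : Quaternion ℝ) : (quatFst q).re = q.re := rfl

theorem im_quatFst (q : Quaternion ℝ) : (quatFst q).im = q.imI := rfl

theorem re_quatSnd (q : Quaternion ℝ) : (quatSnd q).re = q.imJ := rfl

theorem im_quatSnd (q : Quaternion ℝ) : (quatSnd q).im = q.imK := rfl

theorem quatFst_mul (p q : Quaternion ℝ) :
    quatFst (p * q) = quatFst p * quatFst q - quatSnd p * starRingEnd ℂ (quatSnd q) := by
  apply Complex.ext <;> simp [re_quatFst, im_quatFst, re_quatSnd, im_quatSnd] <;> ring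

theorem quatSnd_mul (p q : Quaternion ℝ) :
    quatSnd (p * q) = quatFst p * quatSnd q + quatSnd p * starRingEnd ℂ (quatFst q) := by
  apply Complex.ext <;> simp [re_quatFst, im_quatFst, re_quatSnd, im_quatSnd] <;> ring

theorem part₁_mul {n : ℕ} (Z W : HMat n) :
    part₁ (Z * W) = part₁ Z * part₁ W - part₂ Z * conjMat (part₂ W) := by
  ext i j
  change quatFst ((Z * W) i j) = _
  simp only [Matrix.mul_apply, map_sum, quatFst_mul, Finset.sum_sub_distrib]
  rfl

theorem part₂_mul {n : ℕ} (Z W : HMat n) :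
    part₂ (Z * W) = part₁ Z * part₂ W + part₂ Z * conjMat (part₁ W) := by
  ext i j
  change quatSnd ((Z * W) i j) = _
  simp only [Matrix.mul_apply, map_sum, quatSnd_mul, Finset.sum_add_distrib]
  rfl

theorem quatFst_coe_add (x y : ℂ) : quatFst ((x : Quaternion ℝ) + quatJ * y) = x := by
  have h₁ : quatFst quatJ = 0 := rfl
  apply Complex.ext <;>
    simp [map_add, quatFst_mul, h₁, re_quatFst, im_quatFst, re_quatSnd, im_quatSnd]

theorem quatSnd_coe_add (x y : ℂ) :
    quatSnd ((x : Quaternion ℝ) + quatJ * y) = starRingEnd ℂ y := by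
  have h₁ : quatFst quatJ = 0 := rfl
  have h₂ : quatSnd quatJ = 1 := rfl
  apply Complex.ext <;>
    simp [map_add, quatSnd_mul, h₁, h₂, re_quatFst, im_quatFst, re_quatSnd, im_quatSnd]

theorem part₁_ofParts {n : ℕ} (X Y : CMat n) : part₁ (ofParts X Y) = X := by
  ext i j
  exact quatFst_coe_add (X i j) (Y i j)

theorem part₂_ofParts {n : ℕ} (X Y : CMat n) : part₂ (ofParts X Y) = conjMat Y := by
  ext i j
  exact quatSnd_coe_add (X i j) (Y i j)

theorem part_ext {n : ℕ} {Z W : HMat n} (h₁ : part₁ Z = part₁ W) (h₂ : part₂ Z = part₂ W) :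
    Z = W := by
  refine Matrix.ext fun i j => ?_
  have e₁ := congrFun (congrFun h₁ i) j
  have e₂ := congrFun (congrFun h₂ i) j
  simp only [part₁, part₂, Matrix.map_apply, Complex.mk.injEq] at e₁ e₂
  exact QuaternionAlgebra.ext e₁.1 e₁.2 e₂.1 e₂.2

theorem part₁_one {n : ℕ} : part₁ (1 : HMat n) = 1 :=
  Matrix.map_one quatFst rfl rfl

theorem part₂_one {n : ℕ} : part₂ (1 : HMat n) = 0 := by
  ext i j
  change quatSnd ((1 : HMat n) i j) = 0
  rw [Matrix.one_apply]
  split_ifs <;> rfl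

/-- The equation `Z (X + jY) = 1` for `Z = Z₁ + Z₂ j`, written out for complex matrices. -/
theorem mul_ofParts_eq_one_iff {n : ℕ} (Z : HMat n) (X Y : CMat n) :
    Z * ofParts X Y = 1 ↔ part₁ Z * X - part₂ Z * Y = 1 ∧
      conjMat (part₂ Z) * X + conjMat (part₁ Z) * Y = 0 := by
  have h₂ : part₂ (Z * ofParts X Y) =
      conjMat (conjMat (part₂ Z) * X + conjMat (part₁ Z) * Y) := by
    simp only [part₂_mul, part₁_ofParts, part₂_ofParts, conjMat_add, conjMat_mul, conjMat_conjMat,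
      add_comm]
  have h₁ : part₁ (Z * ofParts X Y) = part₁ Z * X - part₂ Z * Y := by
    simp only [part₁_mul, part₁_ofParts, part₂_ofParts, conjMat_conjMat]
  have h0 : conjMat (0 : CMat n) = 0 := map_zero (starRingEnd ℂ).mapMatrix
  constructor
  · intro h
    refine ⟨by rw [← h₁, h, part₁_one], ?_⟩
    rw [h, part₂_one] at h₂
    rw [← conjMat_conjMat (_ + _), ← h₂, h0]
  · rintro ⟨e₁, e₂⟩
    exact part_ext (by rw [h₁, e₁, part₁_one]) (by rw [h₂, e₂, h0, part₂_one])

/-- The quaternion matrix `Z₁ + Z₂ j = A + iB + jC + kD` with `Z₁ = A + iB` and `Z₂ = C + iD`. -/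
def ofPair {n : ℕ} (Z : CMat n × CMat n) : HMat n := ofParts Z.1 (conjMat Z.2)

theorem part₁_ofPair {n : ℕ} (Z : CMat n × CMat n) : part₁ (ofPair Z) = Z.1 := part₁_ofParts _ _

theorem part₂_ofPair {n : ℕ} (Z : CMat n × CMat n) : part₂ (ofPair Z) = Z.2 := by
  rw [ofPair, part₂_ofParts, conjMat_conjMat]

theorem ofPair_parts {n : ℕ} (Z : HMat n) : ofPair (part₁ Z, part₂ Z) = Z :=
  part_ext (part₁_ofPair _) (part₂_ofPair _)

theorem exists_eq_ofParts {n : ℕ} (Z : HMat n) : ∃ X Y, Z = ofParts X Y :=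
  ⟨_, _, (ofPair_parts Z).symm⟩

theorem continuous_ofPair {n : ℕ} : Continuous (ofPair : CMat n × CMat n → HMat n) := by
  have hc : Continuous (Quaternion.coeComplex : ℂ → Quaternion ℝ) :=
    (Quaternion.ofComplex.toLinearMap).continuous_of_finiteDimensional
  have hs : Continuous (starRingEnd ℂ) := Complex.continuous_conj
  unfold ofPair ofParts conjMat
  exact (continuous_fst.matrix_map hc).add
    (((continuous_snd.matrix_map hs).matrix_map hc).const_smul quatJ)

/-! ### Complex Frobenius inversion -/

theorem returns_frobenius₁ {n : ℕ} {Z₁ Z₂ : CMat n} (h₁ : IsUnit Z₁) (h : IsUnit (schur Z₁ Z₂)) :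
    Returns frobenius₁ 8 Z₁ Z₂ (schur Z₁ Z₂)⁻¹ ∧
      Returns frobenius₁ 10 Z₁ Z₂
        (-((conjMat Z₁)⁻¹ * conjMat Z₂ * (schur Z₁ Z₂)⁻¹)) := by
  have h' : IsUnit (Z₁ + Z₂ * ((conjMat Z₁)⁻¹ * conjMat Z₂)) := by
    rwa [← Matrix.mul_assoc]
  constructor <;>
  exact ⟨_, by simp [frobenius₁, run, Instr.eval, isUnit_conjMat h₁, h']; rfl,
    by simp [schur, Matrix.mul_assoc]⟩

theorem returns_frobenius₂ {n : ℕ} {Z₁ Z₂ : CMat n} (h₂ : IsUnit Z₂)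
    (h : IsUnit (Z₁ * ((conjMat Z₂)⁻¹ * conjMat Z₁) + Z₂)) :
    Returns frobenius₂ 9 Z₁ Z₂ ((conjMat Z₂)⁻¹ * conjMat Z₁ *
        (Z₁ * ((conjMat Z₂)⁻¹ * conjMat Z₁) + Z₂)⁻¹) ∧
      Returns frobenius₂ 10 Z₁ Z₂ (-(Z₁ * ((conjMat Z₂)⁻¹ * conjMat Z₁) + Z₂)⁻¹) := by
  constructor <;>
  exact ⟨_, by simp [frobenius₂, run, Instr.eval, isUnit_conjMat h₂, h]; rfl, by simp⟩

theorem inverts_frobenius₁ {n : ℕ} {Z : HMat n} (hZ : IsUnit Z) (h₁ : IsUnit (part₁ Z)) :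
    Inverts frobenius₁ 8 10 Z := by
  obtain ⟨W, hZW, hWZ⟩ := isUnit_iff_exists.1 hZ
  obtain ⟨X, Y, rfl⟩ := exists_eq_ofParts W
  obtain ⟨e₁, e₂⟩ := (mul_ofParts_eq_one_iff Z X Y).1 hZW
  have hd := (Matrix.isUnit_iff_isUnit_det _).1 (isUnit_conjMat h₁)
  have hY : Y = -((conjMat (part₁ Z))⁻¹ * conjMat (part₂ Z) * X) := by
    rw [← Matrix.nonsing_inv_mul_cancel_left _ Y hd, eq_neg_of_add_eq_zero_right e₂,
      Matrix.mul_neg, Matrix.mul_assoc]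
  have hS : schur (part₁ Z) (part₂ Z) * X = 1 := by
    rw [← e₁, hY, schur, Matrix.add_mul, Matrix.mul_neg, sub_neg_eq_add]
    simp only [Matrix.mul_assoc]
  have hX : (schur (part₁ Z) (part₂ Z))⁻¹ = X := Matrix.inv_eq_right_inv hS
  have hR := returns_frobenius₁ (Z₂ := part₂ Z) h₁ (IsUnit.of_mul_eq_one X hS)
  rw [hX, ← hY] at hR
  exact ⟨X, Y, hR.1, hR.2, hZW, hWZ⟩

theorem inverts_frobenius₂ {n : ℕ} {Z : HMat n} (hZ : IsUnit Z) (h₂ : IsUnit (part₂ Z)) :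
    Inverts frobenius₂ 9 10 Z := by
  obtain ⟨W, hZW, hWZ⟩ := isUnit_iff_exists.1 hZ
  obtain ⟨X, Y, rfl⟩ := exists_eq_ofParts W
  obtain ⟨e₁, e₂⟩ := (mul_ofParts_eq_one_iff Z X Y).1 hZW
  have hd := (Matrix.isUnit_iff_isUnit_det _).1 (isUnit_conjMat h₂)
  have hX : X = (conjMat (part₂ Z))⁻¹ * conjMat (part₁ Z) * -Y := by
    rw [← Matrix.nonsing_inv_mul_cancel_left _ X hd, eq_neg_of_add_eq_zero_left e₂,
      Matrix.mul_neg, Matrix.mul_neg, Matrix.mul_assoc]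
  have hS : (part₁ Z * ((conjMat (part₂ Z))⁻¹ * conjMat (part₁ Z)) + part₂ Z) * -Y = 1 := by
    rw [← e₁, hX, Matrix.add_mul, Matrix.mul_neg, Matrix.mul_neg, Matrix.mul_neg, sub_eq_add_neg]
    simp only [Matrix.mul_assoc, Matrix.mul_neg]
  have hY := Matrix.inv_eq_right_inv hS
  have hR := returns_frobenius₂ h₂ (IsUnit.of_mul_eq_one (-Y) hS)
  rw [hY, ← hX, neg_neg] at hR
  exact ⟨X, Y, hR.1, hR.2, hZW, hWZ⟩

/-! ### Noncommutative polynomials on weighted cyclic shifts -/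

/-- Noncommutative polynomials over `ℂ` in the letters `0, 1, 2, 3`, which stand for
`Z₁, Z₂, conj Z₁, conj Z₂`. -/
abbrev NCPoly : Type := MonoidAlgebra ℂ (FreeMonoid (Fin 4))

/-- Substitution of matrices for the letters of a noncommutative polynomial. -/
def ncEval {n : ℕ} (T : Fin 4 → CMat n) : NCPoly →ₐ[ℂ] CMat n :=
  MonoidAlgebra.lift ℂ (CMat n) (FreeMonoid (Fin 4)) (FreeMonoid.lift T)

theorem ncEval_eq_sum {n : ℕ} (T : Fin 4 → CMat n) (p : NCPoly) :
    ncEval T p = ∑ w ∈ p.coeff.support, p.coeff w • (w.toList.map T).prod := by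
  simp only [ncEval, MonoidAlgebra.lift_apply, Finsupp.sum, FreeMonoid.lift_apply]

/-- The matrix of the cyclic shift of the coordinates. -/
def cyclicShift (k : ℕ) : CMat (k + 1) := Matrix.of fun i j => if j = i + 1 then 1 else 0

theorem cyclicShift_mul_diagonal (k : ℕ) (d : Fin (k + 1) → ℂ) :
    cyclicShift k * diagonal d = diagonal (fun i => d (i + 1)) * cyclicShift k := by
  ext i j
  simp only [Matrix.mul_diagonal, Matrix.diagonal_mul, cyclicShift, Matrix.of_apply]
  split_ifs with h <;> simp [h]

theorem isUnit_cyclicShift (k : ℕ) : IsUnit (cyclicShift k) := by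
  have h : cyclicShift k = Equiv.Perm.permMatrix ℂ (Equiv.addRight (1 : Fin (k + 1))) := by
    ext i j
    simp [cyclicShift, PEquiv.toMatrix_apply, eq_comm]
  rw [h, Matrix.isUnit_iff_isUnit_det, Matrix.det_permutation]
  exact ((Units.isUnit _).map (Int.castRingHom ℂ))

/-- The exponents of the weights of the four letters. Their choice is the point of the construction:
they are distinct, so that a word can be read off from its weights, and `weight 0 + weight 2 =
weight 1 + weight 3`, so that `Z₁ + Z₂ (conj Z₁)⁻¹ (conj Z₂)` can vanish. -/
def weight : Fin 4 → ℕ := ![3, 1, 0, 2]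

/-- The signs of the weights of the four letters. -/
def sign : Fin 4 → ℂ := ![-1, 1, 1, 1]

/-- Weighted cyclic shifts, one for each letter. The weight of the letter `i` at the position `j` is
`± t j ^ weight i`. -/
def weightedShift {k : ℕ} (t : Fin (k + 1) → ℂ) (i : Fin 4) : CMat (k + 1) :=
  diagonal (fun j => sign i * t j ^ weight i) * cyclicShift k

/-- The exponents of the variables `t` in the product of the weights that are met when a word is read
from the position `j` on. -/
def wordExp {k : ℕ} : List (Fin 4) → Fin (k + 1) → (Fin (k + 1) →₀ ℕ)
  | [], _ => 0
  | i :: w, j => Finsupp.single j (weight i) + wordExp w (j + 1)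

theorem prod_map_weightedShift {k : ℕ} (t : Fin (k + 1) → ℂ) (w : List (Fin 4)) :
    (w.map (weightedShift t)).prod =
      diagonal (fun j => MvPolynomial.eval t (MvPolynomial.monomial (wordExp w j)
        (w.map sign).prod)) * cyclicShift k ^ w.length := by
  induction w with
  | nil => simp [wordExp]
  | cons i w ih =>
    rw [List.map_cons, List.prod_cons, ih, weightedShift, List.length_cons, pow_succ',
      Matrix.mul_assoc, ← Matrix.mul_assoc (cyclicShift k), cyclicShift_mul_diagonal,
      Matrix.mul_assoc, ← Matrix.mul_assoc, Matrix.diagonal_mul_diagonal]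
    congr 2
    funext j
    simp only [MvPolynomial.eval_monomial, wordExp, List.map_cons, List.prod_cons]
    rw [Finsupp.prod_add_index' (by simp) (by simp [pow_add]), Finsupp.prod_single_index (by simp)]
    ring

theorem wordExp_apply_of_lt {k : ℕ} (w : List (Fin 4)) (j q : Fin (k + 1))
    (h : ∀ l < w.length, j + Fin.ofNat (k + 1) l ≠ q) : wordExp w j q = 0 := by
  induction w generalizing j with
  | nil => rfl
  | cons i w ih =>
    have h0 : j ≠ q := by simpa using h 0 (by simp)
    rw [wordExp, Finsupp.add_apply, Finsupp.single_eq_of_ne h0.symm, zero_add]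
    refine ih _ fun l hl => ?_
    convert h (l + 1) (by simpa using hl) using 1
    rw [add_assoc]
    congr 1
    apply Fin.ext
    simp [Fin.val_add, add_comm]

/-- A word that is not longer than the cycle passes each position at most once, so it can be read off
from the exponents. -/
theorem wordExp_injective {k : ℕ} (j : Fin (k + 1)) (v w : List (Fin 4))
    (hvw : v.length = w.length) (hk : v.length ≤ k + 1) (h : wordExp v j = wordExp w j) :
    v = w := by
  -- A word of length at most `k` that starts at `j + 1` does not return to `j`.
  have hpos : ∀ (u : List (Fin 4)) (j : Fin (k + 1)), u.length < k + 1 →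
      wordExp u (j + 1) j = 0 := by
    intro u j hu
    refine wordExp_apply_of_lt u _ _ fun l hl h => ?_
    have h1 : (1 : Fin (k + 1)) + Fin.ofNat (k + 1) l = 0 := by
      rwa [add_assoc, add_eq_left] at h
    have h2 := congrArg Fin.val h1
    rw [Fin.val_add] at h2
    simp only [Fin.val_ofNat, Fin.val_one', Fin.val_zero, ← Nat.add_mod] at h2
    have := Nat.le_of_dvd (by omega) (Nat.dvd_of_mod_eq_zero h2)
    omega
  induction v generalizing w j with
  | nil => exact (List.length_eq_zero_iff.1 hvw.symm).symm
  | cons a v ih =>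
    cases w with
    | nil => simp at hvw
    | cons b w =>
      simp only [List.length_cons, Nat.add_right_cancel_iff] at hvw hk
      simp only [wordExp] at h
      have hj := DFunLike.congr_fun h j
      rw [Finsupp.add_apply, Finsupp.add_apply, hpos v j (by omega), hpos w j (by omega)] at hj
      have hab : a = b := by
        have hw : Function.Injective weight := by decide
        exact hw (by simpa using hj)
      subst hab
      rw [ih (j + 1) w hvw (by omega) (add_left_cancel h)]

/-- The words of length `m` that occur in the noncommutative polynomial `p`. -/
def wordsOfLength (p : NCPoly) (m : ℕ) : Finset (FreeMonoid (Fin 4)) :=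
  p.coeff.support.filter fun w => w.toList.length = m

/-- The weight, as a polynomial in `t`, with which the homogeneous part of degree `m` of `p`,
evaluated at the weighted shifts, maps the position `j`. -/
def lengthWeight {k : ℕ} (p : NCPoly) (m : ℕ) (j : Fin (k + 1)) : MvPolynomial (Fin (k + 1)) ℂ :=
  ∑ w ∈ wordsOfLength p m,
    MvPolynomial.monomial (wordExp w.toList j) (p.coeff w * (w.toList.map sign).prod)

theorem lengthWeight_ne_zero {k : ℕ} {p : NCPoly} {m : ℕ} (hm : m ≤ k + 1)
    (hp : (wordsOfLength p m).Nonempty) (j : Fin (k + 1)) : lengthWeight p m j ≠ 0 := by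
  obtain ⟨v, hv⟩ := hp
  intro h
  have hc := congrArg (MvPolynomial.coeff (wordExp v.toList j)) h
  simp only [wordsOfLength, Finset.mem_filter, Finsupp.mem_support_iff] at hv
  rw [lengthWeight, MvPolynomial.coeff_sum, Finset.sum_eq_single v] at hc
  · rw [MvPolynomial.coeff_monomial, if_pos rfl, MvPolynomial.coeff_zero, mul_eq_zero] at hc
    refine hc.elim hv.1 fun h0 => ?_
    rw [List.prod_eq_zero_iff, List.mem_map] at h0
    obtain ⟨i, -, hi⟩ := h0
    revert hi
    fin_cases i <;> simp [sign]
  · intro w hw hne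
    simp only [wordsOfLength, Finset.mem_filter] at hw
    rw [MvPolynomial.coeff_monomial, if_neg]
    intro he
    exact hne (FreeMonoid.toList.injective
      (wordExp_injective j _ _ (hw.2.trans hv.2.symm) (hw.2.trans_le hm) he))
  · intro hn
    exact absurd (by simpa [wordsOfLength] using hv) hn

theorem sum_wordsOfLength {k : ℕ} (t : Fin (k + 1) → ℂ) (p : NCPoly) (m : ℕ) :
    ∑ w ∈ wordsOfLength p m, p.coeff w • (w.toList.map (weightedShift t)).prod =
      diagonal (fun j => MvPolynomial.eval t (lengthWeight p m j)) * cyclicShift k ^ m := by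
  have h : (fun j => MvPolynomial.eval t (lengthWeight p m j)) =
      ∑ w ∈ wordsOfLength p m, fun j => MvPolynomial.eval t
        (MvPolynomial.monomial (wordExp w.toList j) (p.coeff w * (w.toList.map sign).prod)) := by
    funext j
    simp [lengthWeight]
  have hd : ∀ (s : Finset (FreeMonoid (Fin 4))) (g : FreeMonoid (Fin 4) → Fin (k + 1) → ℂ),
      diagonal (∑ w ∈ s, g w) = ∑ w ∈ s, diagonal (g w) := fun s g =>
    map_sum (Matrix.diagonalAddMonoidHom (Fin (k + 1)) ℂ) g s
  rw [h, hd, Finset.sum_mul]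
  refine Finset.sum_congr rfl fun w hw => ?_
  simp only [wordsOfLength, Finset.mem_filter] at hw
  rw [prod_map_weightedShift, hw.2, ← Matrix.smul_mul, ← Matrix.diagonal_smul]
  congr 2
  funext j
  simp only [Pi.smul_apply, smul_eq_mul, MvPolynomial.eval_monomial, mul_assoc]

theorem exists_wordsOfLength_nonempty {p : NCPoly} (hp : p ≠ 0) :
    ∃ m, (wordsOfLength p m).Nonempty ∧ ∀ w ∈ p.coeff.support, m ≤ w.toList.length := by
  have hs : p.coeff.support.Nonempty := by
    rw [Finsupp.support_nonempty_iff]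
    intro h
    exact hp (by ext; simp [h])
  obtain ⟨w, hw, hmin⟩ := p.coeff.support.exists_min_image (fun w => w.toList.length) hs
  exact ⟨_, ⟨w, by simpa [wordsOfLength] using hw⟩, hmin⟩

/-- If the lowest homogeneous part of `p` is invertible at `T`, then `p` is invertible at all
sufficiently small nonzero multiples of `T`. -/
theorem eventually_isUnit_ncEval_smul {n : ℕ} {p : NCPoly} {m : ℕ} {T : Fin 4 → CMat n}
    (hmin : ∀ w ∈ p.coeff.support, m ≤ w.toList.length)
    (h : IsUnit (∑ w ∈ wordsOfLength p m, p.coeff w • (w.toList.map T).prod)) :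
    ∀ᶠ c in nhdsWithin (0 : ℂ) {0}ᶜ, IsUnit (ncEval (c • T) p) := by
  -- `ncEval (c • T) p` divided by `c ^ m`; this is still defined and invertible at `c = 0`.
  let G : ℂ → CMat n := fun c =>
    ∑ w ∈ p.coeff.support, (p.coeff w * c ^ (w.toList.length - m)) • (w.toList.map T).prod
  have hG0 : G 0 = ∑ w ∈ wordsOfLength p m, p.coeff w • (w.toList.map T).prod := by
    rw [wordsOfLength, Finset.sum_filter]
    refine Finset.sum_congr rfl fun w hw => ?_
    split_ifs with hwm
    · simp [hwm]
    · have : w.toList.length - m ≠ 0 := by have := hmin w hw; omega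
      simp [this]
  have hGc : Continuous fun c => (G c).det := by
    refine Continuous.matrix_det ?_
    simp only [G]
    fun_prop
  have hG : ∀ᶠ c in nhds (0 : ℂ), (G c).det ≠ 0 := by
    refine hGc.continuousAt.eventually_ne ?_
    rw [hG0]
    exact ((Matrix.isUnit_iff_isUnit_det _).1 h).ne_zero
  filter_upwards [nhdsWithin_le_nhds hG, self_mem_nhdsWithin] with c hc hc0
  have hs : ncEval (c • T) p = c ^ m • G c := by
    rw [ncEval_eq_sum, Finset.smul_sum]
    refine Finset.sum_congr rfl fun w hw => ?_
    have hw' : ∀ l : List (Fin 4), (l.map (c • T)).prod = c ^ l.length • (l.map T).prod := by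
      intro l
      induction l with
      | nil => simp
      | cons a l ih => simp [ih, pow_succ', smul_smul, mul_comm]
    rw [hw', smul_smul, smul_smul]
    congr 1
    rw [mul_left_comm, ← pow_add, Nat.add_sub_cancel' (hmin w hw)]
  rw [hs, Matrix.isUnit_iff_isUnit_det, Matrix.det_smul]
  exact (mul_ne_zero (pow_ne_zero _ (pow_ne_zero _ hc0)) hc).isUnit

theorem weightedShift_relation {k : ℕ} (t : Fin (k + 1) → ℂ) :
    IsUnit (weightedShift t 2) ∧
      weightedShift t 0 + weightedShift t 1 * (weightedShift t 2)⁻¹ * weightedShift t 3 = 0 := by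
  have h2 : weightedShift t 2 = cyclicShift k := by
    simp [weightedShift, sign, weight]
  have hd := (Matrix.isUnit_iff_isUnit_det _).1 (isUnit_cyclicShift k)
  have hd1 : diagonal (fun _ : Fin (k + 1) => (1 : ℂ)) = 1 := Matrix.diagonal_one
  refine ⟨h2 ▸ isUnit_cyclicShift k, ?_⟩
  rw [h2]
  simp only [weightedShift]
  rw [Matrix.mul_nonsing_inv_cancel_right _ _ hd, ← Matrix.mul_assoc,
    Matrix.diagonal_mul_diagonal, ← Matrix.add_mul, Matrix.diagonal_add]
  convert Matrix.zero_mul _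
  rw [Matrix.diagonal_eq_zero]
  funext j
  simp [sign, weight]
  ring

/-- Two nonzero noncommutative polynomials can be made invertible simultaneously on matrices of any
large size, even under the constraint `x + y z⁻¹ w = 0`. -/
theorem exists_isUnit_ncEval {p p' : NCPoly} (hp : p ≠ 0) (hp' : p' ≠ 0) :
    ∃ N : ℕ, ∀ n ≥ N, ∃ T : Fin 4 → CMat n, IsUnit (T 2) ∧ T 0 + T 1 * (T 2)⁻¹ * T 3 = 0 ∧
      IsUnit (ncEval T p) ∧ IsUnit (ncEval T p') := by
  obtain ⟨m, hne, hmin⟩ := exists_wordsOfLength_nonempty hp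
  obtain ⟨m', hne', hmin'⟩ := exists_wordsOfLength_nonempty hp'
  refine ⟨m + m' + 1, fun n hn => ?_⟩
  obtain ⟨k, rfl⟩ : ∃ k, n = k + 1 := ⟨n - 1, by omega⟩
  obtain ⟨t, ht⟩ : ∃ t : Fin (k + 1) → ℂ,
      MvPolynomial.eval t (∏ j, (lengthWeight p m j * lengthWeight p' m' j)) ≠ 0 := by
    by_contra! h
    have h0 : ∏ j : Fin (k + 1), (lengthWeight p m j * lengthWeight p' m' j) ≠ 0 :=
      Finset.prod_ne_zero_iff.2 fun j _ => mul_ne_zero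
        (lengthWeight_ne_zero (by omega) hne j) (lengthWeight_ne_zero (by omega) hne' j)
    exact h0 (MvPolynomial.funext fun x => by rw [h x, map_zero])
  rw [map_prod, Finset.prod_ne_zero_iff] at ht
  simp only [Finset.mem_univ, map_mul, mul_ne_zero_iff, true_implies] at ht
  have hunit : ∀ (q : NCPoly) (l : ℕ),
      (∀ j : Fin (k + 1), MvPolynomial.eval t (lengthWeight q l j) ≠ 0) →
      IsUnit (∑ w ∈ wordsOfLength q l, q.coeff w • (w.toList.map (weightedShift t)).prod) := by
    intro q l h
    rw [sum_wordsOfLength]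
    refine IsUnit.mul ?_ ((isUnit_cyclicShift k).pow l)
    rw [Matrix.isUnit_diagonal, Pi.isUnit_iff]
    exact fun j => (h j).isUnit
  obtain ⟨c, ⟨hc, hc'⟩, hc0⟩ := ((eventually_isUnit_ncEval_smul hmin
    (hunit p m fun j => (ht j).1)).and (eventually_isUnit_ncEval_smul hmin'
    (hunit p' m' fun j => (ht j).2))).and self_mem_nhdsWithin |>.exists
  replace hc0 : c ≠ 0 := hc0
  obtain ⟨hu, hrel⟩ := weightedShift_relation t
  have hd := (Matrix.isUnit_iff_isUnit_det _).1 hu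
  refine ⟨c • weightedShift t, ?_, ?_, hc, hc'⟩
  · rw [Pi.smul_apply, Matrix.isUnit_iff_isUnit_det, Matrix.det_smul]
    exact ((pow_ne_zero _ hc0).isUnit).mul hd
  · have hinv : (c • weightedShift t 2)⁻¹ = c⁻¹ • (weightedShift t 2)⁻¹ := by
      apply Matrix.inv_eq_left_inv
      rw [Matrix.smul_mul, Matrix.mul_smul, smul_smul, inv_mul_cancel₀ hc0, one_smul,
        Matrix.nonsing_inv_mul _ hd]
    simp only [Pi.smul_apply, hinv, Matrix.smul_mul, Matrix.mul_smul, smul_smul]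
    rw [inv_mul_cancel₀ hc0, mul_one, ← smul_add, hrel, smul_zero]

/-! ### Rational functions of one variable and continuation of identities -/

/-- A matrix of rational functions of one variable, written as a polynomial matrix and a common
denominator. -/
abbrev MatFrac (n : ℕ) : Type := Matrix (Fin n) (Fin n) (Polynomial ℂ) × Polynomial ℂ

/-- Evaluation of a polynomial matrix at `s`. -/
def evalMat {n : ℕ} (s : ℂ) : Matrix (Fin n) (Fin n) (Polynomial ℂ) →+* CMat n :=
  (Polynomial.evalRingHom s).mapMatrix

theorem evalMat_smul {n : ℕ} (s : ℂ) (q : Polynomial ℂ)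
    (N : Matrix (Fin n) (Fin n) (Polynomial ℂ)) :
    evalMat s (q • N) = q.eval s • evalMat s N := by
  ext i j
  simp [evalMat]

/-- The fraction `F` is defined at `s` and has the value `X` there. -/
def MatFrac.HasValue {n : ℕ} (F : MatFrac n) (s : ℂ) (X : CMat n) : Prop :=
  F.2.eval s ≠ 0 ∧ F.2.eval s • X = evalMat s F.1

namespace MatFrac

variable {n : ℕ} {F G : MatFrac n} {s : ℂ} {X Y : CMat n}

/-- The sum of two fractions. -/
def add (F G : MatFrac n) : MatFrac n := (G.2 • F.1 + F.2 • G.1, F.2 * G.2)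

/-- The product of two fractions. -/
def mul (F G : MatFrac n) : MatFrac n := (F.1 * G.1, F.2 * G.2)

/-- A scalar multiple of a fraction. -/
def smul (c : ℂ) (F : MatFrac n) : MatFrac n := (Polynomial.C c • F.1, F.2)

/-- The inverse of a fraction, by the formula with the adjugate matrix. -/
def inv (F : MatFrac n) : MatFrac n := (F.2 • F.1.adjugate, F.1.det)

theorem HasValue.one : HasValue (1, 1) s (1 : CMat n) := by
  simp [HasValue]

theorem HasValue.add (hF : F.HasValue s X) (hG : G.HasValue s Y) :
    (F.add G).HasValue s (X + Y) := by
  refine ⟨by simpa [MatFrac.add] using ⟨hF.1, hG.1⟩, ?_⟩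
  simp only [MatFrac.add, map_add, evalMat_smul, ← hF.2, ← hG.2, Polynomial.eval_mul, smul_add,
    smul_smul, mul_comm]

theorem HasValue.mul (hF : F.HasValue s X) (hG : G.HasValue s Y) :
    (F.mul G).HasValue s (X * Y) := by
  refine ⟨by simpa [MatFrac.mul] using ⟨hF.1, hG.1⟩, ?_⟩
  simp only [MatFrac.mul, map_mul, ← hF.2, ← hG.2, Polynomial.eval_mul, Matrix.smul_mul,
    Matrix.mul_smul, smul_smul, mul_comm]

theorem HasValue.smul (c : ℂ) (hF : F.HasValue s X) : (F.smul c).HasValue s (c • X) := by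
  refine ⟨hF.1, ?_⟩
  simp only [MatFrac.smul, evalMat_smul, ← hF.2, Polynomial.eval_C]
  exact smul_comm _ _ _

theorem HasValue.inv (hF : F.HasValue s X) (hX : IsUnit X) : F.inv.HasValue s X⁻¹ := by
  have hd := (Matrix.isUnit_iff_isUnit_det _).1 hX
  have hdet : F.1.det.eval s = (F.2.eval s • X).det := by
    rw [hF.2]
    exact RingHom.map_det (Polynomial.evalRingHom s) F.1
  have hadj : evalMat s F.1.adjugate = (F.2.eval s • X).adjugate := by
    rw [hF.2]
    exact RingHom.map_adjugate (Polynomial.evalRingHom s) F.1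
  refine ⟨?_, ?_⟩
  · change F.1.det.eval s ≠ 0
    rw [hdet, Matrix.det_smul]
    exact mul_ne_zero (pow_ne_zero _ hF.1) hd.ne_zero
  · simp only [MatFrac.inv, evalMat_smul]
    have h := Matrix.adjugate_mul (F.2.eval s • X)
    rw [Matrix.mul_smul] at h
    rw [hdet, hadj, ← Matrix.one_mul X⁻¹, ← Matrix.smul_mul, ← h, Matrix.smul_mul,
      Matrix.mul_nonsing_inv_cancel_right _ _ hd]

/-- Identity theorem: a fraction that vanishes at infinitely many points vanishes wherever it is
defined. -/
theorem HasValue.eq_zero {D : Set ℂ} (hD : D.Infinite) (hF : ∀ u ∈ D, F.HasValue u 0)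
    (h : F.HasValue s X) : X = 0 := by
  have hN : F.1 = 0 := by
    ext1 i j
    refine Polynomial.eq_zero_of_infinite_isRoot _ (hD.mono fun u hu => ?_)
    have := congrFun (congrFun (hF u hu).2 i) j
    simpa [evalMat] using this.symm
  have := h.2
  rw [hN, map_zero, smul_eq_zero] at this
  exact this.resolve_left h.1

end MatFrac

/-- The complexified interpretation over rational functions of one variable. -/
def fracOps (n : ℕ) : Ops (MatFrac n × MatFrac n) where
  one := ((1, 1), (1, 1))
  add F G := (F.1.add G.1, F.2.add G.2)
  mul F G := (F.1.mul G.1, F.2.mul G.2)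
  smul c F := (F.1.smul c, F.2.smul (starRingEnd ℂ c))
  conj F := F.swap
  inv F := some (F.1.inv, F.2.inv)

theorem sim_pairOps_fracOps (n : ℕ) (s : ℂ) :
    Sim (pairOps n) (fracOps n) (fun X F => F.1.HasValue s X.1 ∧ F.2.HasValue s X.2)
      True True where
  one := ⟨.one, .one⟩
  add _ _ _ _ _ h h' := ⟨h.1.add h'.1, h.2.add h'.2⟩
  mul h h' := ⟨h.1.mul h'.1, h.2.mul h'.2⟩
  smul c _ _ h := ⟨h.1.smul c, h.2.smul _⟩
  conj h := ⟨h.2, h.1⟩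
  inv := by
    rintro - X F U h hU
    simp only [pairOps, Option.ite_none_right_eq_some, Option.some.injEq] at hU
    obtain ⟨hX, rfl⟩ := hU
    exact ⟨_, rfl, h.1.inv hX.1, h.2.inv hX.2⟩

/-- The polynomial curve `A + sB + s²C`. -/
def quadCurve {n : ℕ} (A B C : CMat n) : MatFrac n :=
  (A.map Polynomial.C + (Polynomial.X : Polynomial ℂ) • B.map Polynomial.C +
    (Polynomial.X ^ 2 : Polynomial ℂ) • C.map Polynomial.C, 1)

theorem quadCurve_hasValue {n : ℕ} (A B C : CMat n) (s : ℂ) :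
    (quadCurve A B C).HasValue s (A + s • B + s ^ 2 • C) := by
  refine ⟨by simp [quadCurve], ?_⟩
  ext i j
  simp [quadCurve, evalMat]
  ring

/-- Every point `(x, z)` can be joined to a point `(Z, conj Z)` by a quadratic curve that runs through
points of the form `(Z', conj Z')` at all real parameters; the end point is reached at the parameter
`i`. -/
theorem exists_quadCurve {n : ℕ} (Z x z : CMat n) : ∃ B C : CMat n,
    Z + Complex.I • B + Complex.I ^ 2 • C = x ∧
      conjMat Z + Complex.I • conjMat B + Complex.I ^ 2 • conjMat C = z := by
  refine ⟨(-Complex.I / 2) • (x - conjMat z), Z - (1 / 2 : ℂ) • (x + conjMat z), ?_, ?_⟩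
  · ext i j
    simp only [Matrix.add_apply, Matrix.smul_apply, Matrix.sub_apply, smul_eq_mul, Complex.I_sq]
    linear_combination (-(1 / 2 : ℂ) * (x i j - conjMat z i j)) * Complex.I_sq
  · ext i j
    simp only [conjMat_smul, conjMat_sub, conjMat_add, conjMat_conjMat, Matrix.add_apply,
      Matrix.smul_apply, Matrix.sub_apply, smul_eq_mul, Complex.I_sq, map_div₀, map_neg,
      Complex.conj_I, map_ofNat, map_one]
    linear_combination ((1 / 2 : ℂ) * (conjMat x i j - z i j)) * Complex.I_sq

theorem conjMat_quadCurve {n : ℕ} (A B C : CMat n) (s : ℝ) :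
    conjMat (A + (s : ℂ) • B + (s : ℂ) ^ 2 • C) =
      conjMat A + (s : ℂ) • conjMat B + (s : ℂ) ^ 2 • conjMat C := by
  simp only [conjMat_add, conjMat_smul, map_pow, Complex.conj_ofReal]

/-- Continuation from an open set of inputs to a point `(x, y, z, w)` of the complexification. There
are fractions `x', y', z', w'` of one variable that have the values `x, y, z, w` at the parameter `i`
and, at infinitely many parameters, the values `Z₁, Z₂, conj Z₁, conj Z₂` for some `(Z₁, Z₂) ∈ U`. -/
theorem exists_curve_through {n : ℕ} {U : Set (CMat n × CMat n)} (hU : IsOpen U) (hne : U.Nonempty)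
    (x y z w : CMat n) : ∃ x' y' z' w' : MatFrac n,
      (x'.HasValue Complex.I x ∧ y'.HasValue Complex.I y ∧ z'.HasValue Complex.I z ∧
        w'.HasValue Complex.I w) ∧
      ∃ D : Set ℂ, D.Infinite ∧ ∀ s ∈ D, ∃ Z ∈ U, x'.HasValue s Z.1 ∧ y'.HasValue s Z.2 ∧
        z'.HasValue s (conjMat Z.1) ∧ w'.HasValue s (conjMat Z.2) := by
  obtain ⟨⟨Z₁, Z₂⟩, hZ⟩ := hne
  obtain ⟨B₁, C₁, hx, hz⟩ := exists_quadCurve Z₁ x z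
  obtain ⟨B₂, C₂, hy, hw⟩ := exists_quadCurve Z₂ y w
  refine ⟨quadCurve Z₁ B₁ C₁, quadCurve Z₂ B₂ C₂, quadCurve (conjMat Z₁) (conjMat B₁) (conjMat C₁),
    quadCurve (conjMat Z₂) (conjMat B₂) (conjMat C₂),
    ⟨hx ▸ quadCurve_hasValue _ _ _ _, hy ▸ quadCurve_hasValue _ _ _ _,
      hz ▸ quadCurve_hasValue _ _ _ _, hw ▸ quadCurve_hasValue _ _ _ _⟩, ?_⟩
  let c : ℝ → CMat n × CMat n := fun s =>
    (Z₁ + (s : ℂ) • B₁ + (s : ℂ) ^ 2 • C₁, Z₂ + (s : ℂ) • B₂ + (s : ℂ) ^ 2 • C₂)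
  have hc : Continuous c := by fun_prop
  have hmem : c ⁻¹' U ∈ nhds (0 : ℝ) :=
    hc.continuousAt.preimage_mem_nhds (hU.mem_nhds (by simpa [c] using hZ))
  refine ⟨(fun s : ℝ => (s : ℂ)) '' (c ⁻¹' U),
    (infinite_of_mem_nhds _ hmem).image Complex.ofReal_injective.injOn, ?_⟩
  rintro _ ⟨s, hs, rfl⟩
  refine ⟨c s, hs, quadCurve_hasValue _ _ _ _, quadCurve_hasValue _ _ _ _, ?_, ?_⟩
  · simp only [c, conjMat_quadCurve]
    exact quadCurve_hasValue _ _ _ _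
  · simp only [c, conjMat_quadCurve]
    exact quadCurve_hasValue _ _ _ _

/-- The program is defined, in the complexified interpretation, at some point where `z` is
invertible and the Schur complement `x + y z⁻¹ w` vanishes. -/
def DefinedAtDegenerate (P : Program) (n : ℕ) : Prop :=
  ∃ x y z w : CMat n, IsUnit z ∧ x + y * z⁻¹ * w = 0 ∧
    ∃ R, (pairOps n).run P (pairInput x y z w) = some R

/-- The registers of a program along a curve are given by fractions of one variable, the same at all
parameters. -/
theorem exists_frac_of_returns {n : ℕ} {P : Program} {x y z w : CMat n}
    {R : List (CMat n × CMat n)} (hR : (pairOps n).run P (pairInput x y z w) = some R)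
    {x' y' z' w' : MatFrac n} {s₀ : ℂ} (hx : x'.HasValue s₀ x) (hy : y'.HasValue s₀ y)
    (hz : z'.HasValue s₀ z) (hw : w'.HasValue s₀ w) (r : ℕ) (hr : r < R.length) :
    ∃ (F : MatFrac n) (V : CMat n), F.HasValue s₀ V ∧
      ∀ (s : ℂ) (Z₁ Z₂ W : CMat n), x'.HasValue s Z₁ → y'.HasValue s Z₂ →
        z'.HasValue s (conjMat Z₁) → w'.HasValue s (conjMat Z₂) → Returns P r Z₁ Z₂ W →
        F.HasValue s W := by
  obtain ⟨S, hS, hRS⟩ := (sim_pairOps_fracOps n s₀).run (.inl trivial) (.inl trivial)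
    (R := [(x', z'), (y', w')]) (.cons ⟨hx, hz⟩ (.cons ⟨hy, hw⟩ .nil)) hR
  obtain ⟨F, hF, hV⟩ := exists_getElem?_of_forall₂ hRS (List.getElem?_eq_getElem hr)
  refine ⟨F.1, _, hV.1, fun s Z₁ Z₂ W h₁ h₂ h₃ h₄ hW => ?_⟩
  obtain ⟨R₁, hR₁, hr₁⟩ := exists_pairOps_run_of_returns hW
  obtain ⟨S₁, hS₁, hRS₁⟩ := (sim_pairOps_fracOps n s).run (.inl trivial) (.inl trivial)
    (R := [(x', z'), (y', w')]) (.cons ⟨h₁, h₃⟩ (.cons ⟨h₂, h₄⟩ .nil)) hR₁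
  -- `fracOps` does not involve the parameter, so the execution at `s` gives the same fractions.
  obtain rfl : S = S₁ := Option.some.inj (hS.symm.trans hS₁)
  obtain ⟨G, hG, hV'⟩ := exists_getElem?_of_forall₂ hRS₁ hr₁
  obtain rfl : F = G := Option.some.inj (hF.symm.trans hG)
  exact hV'.1

theorem Ops.run_length {α : Type} (o : Ops α) {P : Program} {S S' : List α}
    (h : o.run P S = some S') : S'.length = S.length + P.length := by
  induction P generalizing S with
  | nil =>
    obtain rfl : S = S' := by simpa [Ops.run] using h
    simp
  | cons I P ih =>
    simp only [Ops.run, Option.bind_eq_some_iff] at h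
    obtain ⟨X, -, h⟩ := h
    rw [ih h, List.length_append, List.length_cons, List.length_cons, List.length_nil]
    omega

theorem Returns.lt_length {n : ℕ} {P : Program} {r : ℕ} {Z₁ Z₂ W : CMat n}
    (h : Returns P r Z₁ Z₂ W) : r < 2 + P.length := by
  obtain ⟨S, hS, hr⟩ := h
  rw [run_eq_matOps_run] at hS
  rw [← show S.length = 2 + P.length from (matOps n).run_length hS]
  exact (List.getElem?_eq_some_iff.1 hr).1

/-- A program that is defined at a point with vanishing Schur complement does not compute the inverse
of the Schur complement: by continuation, the identity `W * schur = 1` would hold at that point. -/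
theorem not_computesSchurInv {P : Program} {n : ℕ} (hn : n ≠ 0) (h : DefinedAtDegenerate P n)
    (r : ℕ) : ¬ ComputesSchurInv P r n := by
  rintro ⟨U, hU, hne, hP⟩
  obtain ⟨x, y, z, w, hzu, hrel, R, hR⟩ := h
  obtain ⟨x', y', z', w', ⟨hx, hy, hz, hw⟩, D, hD, hDU⟩ := exists_curve_through hU hne x y z w
  have hr : r < R.length := by
    obtain ⟨Z, hZ⟩ := hne
    rw [(pairOps n).run_length hR]
    exact (hP Z hZ).2.2.lt_length
  obtain ⟨F, V, hV, hF⟩ := exists_frac_of_returns hR hx hy hz hw r hr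
  have := MatFrac.HasValue.eq_zero hD (fun s hs => ?_)
    ((hV.mul (hx.add ((hy.mul (hz.inv hzu)).mul hw))).add (MatFrac.HasValue.one.smul (-1)))
  · rw [hrel, Matrix.mul_zero, zero_add, smul_eq_zero] at this
    have : NeZero n := ⟨hn⟩
    simp_all
  · obtain ⟨Z, hZ, h₁, h₂, h₃, h₄⟩ := hDU s hs
    obtain ⟨hu, hsu, hret⟩ := hP Z hZ
    convert ((hF s _ _ _ h₁ h₂ h₃ h₄ hret).mul (h₁.add ((h₂.mul (h₃.inv (isUnit_conjMat hu))).mul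
      h₄))).add (MatFrac.HasValue.one.smul (-1)) using 1
    change 0 = (schur Z.1 Z.2)⁻¹ * schur Z.1 Z.2 + (-1 : ℂ) • 1
    rw [Matrix.nonsing_inv_mul _ ((Matrix.isUnit_iff_isUnit_det _).1 hsu)]
    simp

/-- A program that is defined at a point with vanishing Schur complement does not invert quaternion
matrices: by continuation, the complex form of the equation `Z * Z⁻¹ = 1` would hold at that
point. -/
theorem not_computesQuatInv {P : Program} {n : ℕ} (hn : n ≠ 0) (h : DefinedAtDegenerate P n)
    (r s : ℕ) : ¬ ComputesQuatInv P r s n := by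
  rintro ⟨U, hU, hne, hP⟩
  obtain ⟨x, y, z, w, hzu, hrel, R, hR⟩ := h
  have hU' : IsOpen (ofPair ⁻¹' U : Set (CMat n × CMat n)) := hU.preimage continuous_ofPair
  obtain ⟨Q, hQ⟩ := hne
  have hne' : (ofPair ⁻¹' U : Set (CMat n × CMat n)).Nonempty :=
    ⟨(part₁ Q, part₂ Q), by rwa [Set.mem_preimage, ofPair_parts]⟩
  obtain ⟨x', y', z', w', ⟨hx, hy, hz, hw⟩, D, hD, hDU⟩ := exists_curve_through hU' hne' x y z w
  have hrs : r < R.length ∧ s < R.length := by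
    rw [(pairOps n).run_length hR]
    obtain ⟨_, _, h₁, h₂, -⟩ := hP Q hQ
    exact ⟨h₁.lt_length, h₂.lt_length⟩
  obtain ⟨F, V, hV, hF⟩ := exists_frac_of_returns hR hx hy hz hw r hrs.1
  obtain ⟨G, V', hV', hG⟩ := exists_frac_of_returns hR hx hy hz hw s hrs.2
  have key : ∀ u ∈ D, ∃ Z₁ Z₂ X Y : CMat n, x'.HasValue u Z₁ ∧ y'.HasValue u Z₂ ∧
      z'.HasValue u (conjMat Z₁) ∧ w'.HasValue u (conjMat Z₂) ∧ F.HasValue u X ∧ G.HasValue u Y ∧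
      Z₁ * X - Z₂ * Y = 1 ∧ conjMat Z₂ * X + conjMat Z₁ * Y = 0 := by
    intro u hu
    obtain ⟨Z, hZ, h₁, h₂, h₃, h₄⟩ := hDU u hu
    obtain ⟨X, Y, hX, hY, hXY, -⟩ := hP _ hZ
    rw [mul_ofParts_eq_one_iff] at hXY
    rw [part₁_ofPair, part₂_ofPair] at hX hY hXY
    exact ⟨_, _, X, Y, h₁, h₂, h₃, h₄, hF u _ _ _ h₁ h₂ h₃ h₄ hX, hG u _ _ _ h₁ h₂ h₃ h₄ hY, hXY⟩
  have e₁ := MatFrac.HasValue.eq_zero hD (fun u hu => by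
    obtain ⟨Z₁, Z₂, X, Y, h₁, h₂, h₃, h₄, hX, hY, e₁, e₂⟩ := key u hu
    convert ((h₁.mul hX).add ((h₂.mul hY).smul (-1))).add (MatFrac.HasValue.one.smul (-1)) using 1
    rw [neg_one_smul, neg_one_smul, ← sub_eq_add_neg (Z₁ * X), e₁, add_neg_cancel])
    (((hx.mul hV).add ((hy.mul hV').smul (-1))).add (MatFrac.HasValue.one.smul (-1)))
  have e₂ := MatFrac.HasValue.eq_zero hD (fun u hu => by
    obtain ⟨Z₁, Z₂, X, Y, h₁, h₂, h₃, h₄, hX, hY, e₁, e₂⟩ := key u hu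
    exact e₂ ▸ (h₄.mul hX).add (h₃.mul hY)) ((hw.mul hV).add (hz.mul hV'))
  have hd := (Matrix.isUnit_iff_isUnit_det _).1 hzu
  have hY : V' = -(z⁻¹ * (w * V)) := by
    rw [← Matrix.nonsing_inv_mul_cancel_left _ V' hd, eq_neg_of_add_eq_zero_right e₂,
      Matrix.mul_neg]
  have h0 : (1 : CMat n) = (x + y * z⁻¹ * w) * V := by
    rw [neg_one_smul, neg_one_smul, add_neg_eq_zero] at e₁
    rw [← e₁, hY, Matrix.add_mul, Matrix.mul_neg, neg_neg]
    simp only [Matrix.mul_assoc]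
  rw [hrel, Matrix.zero_mul] at h0
  have : NeZero n := ⟨hn⟩
  exact one_ne_zero h0

/-! ### Programs without additions or with at most one inversion -/

theorem definedAtDegenerate_of_sim {α : Type} {a : Ops α} {n : ℕ} {ρ : α → CMat n × CMat n → Prop}
    {okAdd okInv : Prop} (h : Sim a (pairOps n) ρ okAdd okInv) {P : Program}
    (hA : okAdd ∨ addCount P = 0) (hI : okInv ∨ invCount P = 0) {u v : α} {S : List α}
    (hS : a.run P [u, v] = some S) (hu : ρ u (-1, 1)) (hv : ρ v (1, 1)) :
    DefinedAtDegenerate P n := by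
  obtain ⟨R, hR, -⟩ := h.run hA hI (R := pairInput (-1) 1 1 1) (.cons hu (.cons hv .nil)) hS
  exact ⟨-1, 1, 1, 1, isUnit_one, by simp, R, hR⟩

/-- A relation that holds for all pairs of values is preserved as long as nothing is inverted. -/
theorem sim_true {α β : Type} (a : Ops α) (b : Ops β) : Sim a b (fun _ _ => True) True False where
  one := trivial
  add _ _ _ _ _ _ _ := trivial
  mul _ _ := trivial
  smul _ _ _ _ := trivial
  conj _ := trivial
  inv h := h.elim

/-- Without additions, a register that is nonzero at some input is invertible at all invertible
inputs. -/
theorem sim_matOps_pairOps_isUnit {n : ℕ} (hn : n ≠ 0) :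
    Sim (matOps n) (pairOps n) (fun X A => X ≠ 0 → IsUnit A.1 ∧ IsUnit A.2) False True where
  one _ := ⟨isUnit_one, isUnit_one⟩
  add h := h.elim
  mul := by
    intro x y x' y' hx hy hxy
    have h₁ := hx (left_ne_zero_of_mul hxy)
    have h₂ := hy (right_ne_zero_of_mul hxy)
    exact ⟨h₁.1.mul h₂.1, h₁.2.mul h₂.2⟩
  smul := by
    intro c x x' hx hcx
    have hc : c ≠ 0 := fun h => hcx (by simp [matOps, h])
    have h := hx fun h => hcx (by simp [matOps, h])
    have hc' : starRingEnd ℂ c ≠ 0 := by simpa using hc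
    exact ⟨h.1.smul (Units.mk0 c hc), h.2.smul (Units.mk0 _ hc')⟩
  conj := by
    intro x x' hx hcx
    have h := hx fun h => hcx (by subst h; exact map_zero (starRingEnd ℂ).mapMatrix)
    exact ⟨h.2, h.1⟩
  inv := by
    intro _ x x' u hx hu
    have : NeZero n := ⟨hn⟩
    simp only [matOps, Option.ite_none_right_eq_some] at hu
    obtain ⟨h₁, h₂⟩ := hx hu.1.ne_zero
    refine ⟨(x'.1⁻¹, x'.2⁻¹), by simp [pairOps, h₁, h₂], fun _ => ?_⟩
    exact ⟨Matrix.isUnit_nonsing_inv_iff.2 h₁, Matrix.isUnit_nonsing_inv_iff.2 h₂⟩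

/-- The complexified interpretation over noncommutative polynomials, in which nothing can be
inverted. -/
def polyOps : Ops (NCPoly × NCPoly) where
  one := 1
  add p q := p + q
  mul p q := p * q
  smul c p := (c • p.1, starRingEnd ℂ c • p.2)
  conj p := p.swap
  inv _ := none

/-- The variable `i` as a noncommutative polynomial. -/
def polyVar (i : Fin 4) : NCPoly := MonoidAlgebra.of ℂ _ (FreeMonoid.of i)

/-- The inputs `Z₁`, `Z₂` of a program as pairs of noncommutative polynomials. -/
def polyInput : List (NCPoly × NCPoly) := [(polyVar 0, polyVar 2), (polyVar 1, polyVar 3)]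

theorem ncEval_polyVar {n : ℕ} (T : Fin 4 → CMat n) (i : Fin 4) : ncEval T (polyVar i) = T i := by
  simp [ncEval, polyVar]

/-- The relation between a pair of noncommutative polynomials and its values at `T`. -/
def EvalRel {n : ℕ} (T : Fin 4 → CMat n) (p : NCPoly × NCPoly) (X : CMat n × CMat n) : Prop :=
  X = (ncEval T p.1, ncEval T p.2)

theorem forall₂_polyInput {n : ℕ} (T : Fin 4 → CMat n) :
    List.Forall₂ (EvalRel T) polyInput (pairInput (T 0) (T 1) (T 2) (T 3)) :=
  .cons (by simp [EvalRel, ncEval_polyVar]) (.cons (by simp [EvalRel, ncEval_polyVar]) .nil)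

theorem sim_polyOps_pairOps {n : ℕ} (T : Fin 4 → CMat n) :
    Sim polyOps (pairOps n) (EvalRel T) True False where
  one := by simp [EvalRel, polyOps, pairOps, Prod.one_eq_mk]
  add := by rintro - x y _ _ rfl rfl; simp [EvalRel, polyOps, pairOps]
  mul := by rintro x y _ _ rfl rfl; simp [EvalRel, polyOps, pairOps]
  smul := by rintro c x _ rfl; simp [EvalRel, polyOps, pairOps]
  conj := by rintro x _ rfl; simp [EvalRel, polyOps, pairOps]
  inv h := h.elim

theorem exists_eq_append_inv {P : Program} (h : invCount P = 1) :
    ∃ (P₁ P₂ : Program) (i : ℕ), P = P₁ ++ .inv i :: P₂ ∧ invCount P₁ = 0 ∧ invCount P₂ = 0 := by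
  obtain ⟨I, hI, hIi⟩ := List.countP_pos_iff.1 (by rw [← invCount, h]; exact one_pos)
  obtain ⟨P₁, P₂, rfl⟩ := List.append_of_mem hI
  cases I with
  | inv i =>
    refine ⟨P₁, P₂, i, rfl, ?_⟩
    rw [invCount, List.countP_append, List.countP_cons_of_pos hIi] at h
    rw [invCount, invCount]
    omega
  | _ => simp [Instr.isInv] at hIi

/-- With a single inversion, the inverted matrix and its conjugate are given by noncommutative
polynomials that do not depend on `n`, so they can be made invertible at a point with vanishing
Schur complement as soon as `n` is large. -/
theorem exists_definedAtDegenerate_of_invCount_eq_one {P : Program} (h : invCount P = 1) {m : ℕ}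
    (hm : m ≠ 0) {Z₁ Z₂ : CMat m} {S : List (CMat m)} (hS : run P [Z₁, Z₂] = some S) :
    ∃ N, ∀ n ≥ N, DefinedAtDegenerate P n := by
  have : NeZero m := ⟨hm⟩
  obtain ⟨P₁, P₂, i, rfl, hP₁, hP₂⟩ := exists_eq_append_inv h
  rw [run_eq_matOps_run] at hS
  obtain ⟨R, hR, -⟩ := (sim_matOps_pairOps m).run (.inl trivial) (.inl trivial)
    (R := pairInput Z₁ Z₂ (conjMat Z₁) (conjMat Z₂)) (.cons rfl (.cons rfl .nil)) hS
  simp only [Ops.run_append, Ops.run, Option.bind_eq_some_iff, Ops.eval] at hR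
  obtain ⟨R₁, hR₁, V, ⟨X, hX, hV⟩, hR₂⟩ := hR
  -- Without inversions, the program can be executed on noncommutative polynomials.
  obtain ⟨Q, hQ, -⟩ := (sim_true (pairOps m) polyOps).run (.inl trivial) (.inr hP₁)
    (R := polyInput) (.cons trivial (.cons trivial .nil)) hR₁
  have hrun : ∀ {n : ℕ} (T : Fin 4 → CMat n), ∃ R',
      (pairOps n).run P₁ (pairInput (T 0) (T 1) (T 2) (T 3)) = some R' ∧
        List.Forall₂ (EvalRel T) Q R' := fun T =>
    (sim_polyOps_pairOps T).run (.inl trivial) (.inr hP₁) (forall₂_polyInput T) hQ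
  -- The two polynomials are nonzero, since their values at the given input of size `m` are inverted.
  obtain ⟨R₁', hR₁', hQR⟩ := hrun ![Z₁, Z₂, conjMat Z₁, conjMat Z₂]
  obtain rfl : R₁ = R₁' := Option.some.inj (hR₁.symm.trans hR₁')
  have hi : i < Q.length := hQR.length_eq ▸ (List.getElem?_eq_some_iff.1 hX).1
  obtain ⟨X', hX', hXQ⟩ := exists_getElem?_of_forall₂ hQR (List.getElem?_eq_getElem hi)
  obtain rfl : X = X' := Option.some.inj (hX.symm.trans hX')
  simp only [pairOps, Option.ite_none_right_eq_some] at hV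
  rw [EvalRel] at hXQ
  rw [hXQ] at hV
  have hp : Q[i].1 ≠ 0 := fun h0 => hV.1.1.ne_zero (by rw [h0, map_zero])
  have hp' : Q[i].2 ≠ 0 := fun h0 => hV.1.2.ne_zero (by rw [h0, map_zero])
  obtain ⟨N, hN⟩ := exists_isUnit_ncEval hp hp'
  refine ⟨N, fun n hn => ?_⟩
  obtain ⟨T, hT, hrel, hu, hu'⟩ := hN n hn
  obtain ⟨R', hR', hQR'⟩ := hrun T
  obtain ⟨Y, hY, hYQ⟩ := exists_getElem?_of_forall₂ hQR' (List.getElem?_eq_getElem hi)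
  have hlen : R₁.length = R'.length := hQR.length_eq.symm.trans hQR'.length_eq
  -- After the inversion nothing can fail any more: only the number of registers matters.
  obtain ⟨R'', hR'', -⟩ := (sim_true (pairOps m) (pairOps n)).run (.inl trivial) (.inr hP₂)
    (S := R₁ ++ [V]) (R := R' ++ [(Y.1⁻¹, Y.2⁻¹)])
    (List.forall₂_iff_get.2 ⟨by simp [hlen], fun _ _ _ => trivial⟩) hR₂
  refine ⟨T 0, T 1, T 2, T 3, hT, hrel, R'', ?_⟩
  simp only [Ops.run_append, Ops.run, Option.bind_eq_some_iff, Ops.eval]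
  refine ⟨R', hR', _, ⟨Y, hY, ?_⟩, hR''⟩
  rw [EvalRel] at hYQ
  simp [pairOps, hYQ, hu, hu']

/-- A program that is defined somewhere in infinitely many sizes, and that violates one of the two
bounds, is defined at a point with vanishing Schur complement in every large size in which it is
defined somewhere. -/
theorem eventually_definedAtDegenerate {P : Program} (hP : addCount P = 0 ∨ invCount P ≤ 1)
    (h : ∃ᶠ n : ℕ in atTop, ∃ (Z₁ Z₂ : CMat n) (S : List (CMat n)), run P [Z₁, Z₂] = some S) :
    ∀ᶠ n : ℕ in atTop, (∃ (Z₁ Z₂ : CMat n) (S : List (CMat n)), run P [Z₁, Z₂] = some S) →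
      DefinedAtDegenerate P n := by
  have hpos : ∀ᶠ n : ℕ in atTop, n ≠ 0 := eventually_ne_atTop 0
  by_cases h1 : invCount P = 1 ∧ addCount P ≠ 0
  · obtain ⟨m, ⟨Z₁, Z₂, S, hS⟩, hm⟩ := (h.and_eventually hpos).exists
    obtain ⟨N, hN⟩ := exists_definedAtDegenerate_of_invCount_eq_one h1.1 hm hS
    exact eventually_atTop.2 ⟨N, fun n hn _ => hN n hn⟩
  · filter_upwards [hpos] with n hn
    rintro ⟨Z₁, Z₂, S, hS⟩
    rw [run_eq_matOps_run] at hS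
    have h2 : addCount P = 0 ∨ invCount P = 0 := by omega
    rcases h2 with h2 | h2
    · exact definedAtDegenerate_of_sim (sim_matOps_pairOps_isUnit hn) (.inr h2) (.inl trivial) hS
        (fun _ => ⟨isUnit_one.neg, isUnit_one⟩) (fun _ => ⟨isUnit_one, isUnit_one⟩)
    · exact definedAtDegenerate_of_sim (sim_true _ _) (.inl trivial) (.inr h2) hS trivial trivial

theorem ComputesSchurInv.exists_run {P : Program} {r n : ℕ} (h : ComputesSchurInv P r n) :
    ∃ (Z₁ Z₂ : CMat n) (S : List (CMat n)), run P [Z₁, Z₂] = some S := by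
  obtain ⟨U, -, ⟨Z, hZ⟩, hU⟩ := h
  obtain ⟨-, -, S, hS, -⟩ := hU Z hZ
  exact ⟨_, _, S, hS⟩

theorem ComputesQuatInv.exists_run {P : Program} {r s n : ℕ} (h : ComputesQuatInv P r s n) :
    ∃ (Z₁ Z₂ : CMat n) (S : List (CMat n)), run P [Z₁, Z₂] = some S := by
  obtain ⟨U, -, ⟨Z, hZ⟩, hU⟩ := h
  obtain ⟨_, _, ⟨S, hS, -⟩, -⟩ := hU Z hZ
  exact ⟨_, _, S, hS⟩

/-- Both lower bounds, for any task `C` that a program defined at a point with vanishing Schur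
complement cannot accomplish. -/
theorem lower_bounds {P : Program} {C : ℕ → Prop} (hC : ∃ᶠ n : ℕ in atTop, C n)
    (hrun : ∀ n, C n → ∃ (Z₁ Z₂ : CMat n) (S : List (CMat n)), run P [Z₁, Z₂] = some S)
    (hnot : ∀ n ≠ 0, DefinedAtDegenerate P n → ¬ C n) : 1 ≤ addCount P ∧ 2 ≤ invCount P := by
  by_contra hcon
  have hev := eventually_definedAtDegenerate (P := P) (by omega) (hC.mono hrun)
  obtain ⟨n, ⟨hn, hdef⟩, hn0⟩ := ((hC.and_eventually hev).and_eventually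
    (eventually_ne_atTop 0)).exists
  exact hnot n hn0 (hdef (hrun n hn)) hn

end FrobInv

end

/-- Lower bounds for `(Z₁ + Z₂ (conj Z₁)⁻¹ (conj Z₂))⁻¹` and for the inversion of quaternion
matrices, and the fact that complex Frobenius inversion attains them. -/
theorem mainTheorem1 :
    (∀ (P : FrobInv.Program) (r : ℕ),
      (∃ᶠ n : ℕ in Filter.atTop, FrobInv.ComputesSchurInv P r n) →
        1 ≤ FrobInv.addCount P ∧ 2 ≤ FrobInv.invCount P) ∧
    (∀ (P : FrobInv.Program) (r s : ℕ),
      (∃ᶠ n : ℕ in Filter.atTop, FrobInv.ComputesQuatInv P r s n) →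
        1 ≤ FrobInv.addCount P ∧ 2 ≤ FrobInv.invCount P) ∧
    (FrobInv.addCount FrobInv.frobenius₁ = 1 ∧ FrobInv.invCount FrobInv.frobenius₁ = 2 ∧
      FrobInv.addCount FrobInv.frobenius₂ = 1 ∧ FrobInv.invCount FrobInv.frobenius₂ = 2) ∧
    (∀ (n : ℕ) (Z₁ Z₂ : FrobInv.CMat n), IsUnit Z₁ → IsUnit (FrobInv.schur Z₁ Z₂) →
      FrobInv.Returns FrobInv.frobenius₁ 8 Z₁ Z₂ (FrobInv.schur Z₁ Z₂)⁻¹) ∧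
    (∀ (n : ℕ) (Z : FrobInv.HMat n), IsUnit Z → IsUnit (FrobInv.part₁ Z) →
      FrobInv.Inverts FrobInv.frobenius₁ 8 10 Z) ∧
    (∀ (n : ℕ) (Z : FrobInv.HMat n), IsUnit Z → IsUnit (FrobInv.part₂ Z) →
      FrobInv.Inverts FrobInv.frobenius₂ 9 10 Z) :=
  ⟨fun _ r hC => FrobInv.lower_bounds hC (fun _ => FrobInv.ComputesSchurInv.exists_run)
      fun _ hn h => FrobInv.not_computesSchurInv hn h r,
    fun _ r s hC => FrobInv.lower_bounds hC (fun _ => FrobInv.ComputesQuatInv.exists_run)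
      fun _ hn h => FrobInv.not_computesQuatInv hn h r s,
    ⟨rfl, rfl, rfl, rfl⟩,
    fun _ _ _ h₁ h => (FrobInv.returns_frobenius₁ h₁ h).1,
    fun _ _ hZ h₁ => FrobInv.inverts_frobenius₁ hZ h₁,
    fun _ _ hZ h₂ => FrobInv.inverts_frobenius₂ hZ h₂⟩
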